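/- Let $n\ge 2$ and let $H=(\mathbb C^2)^{\otimes n}$ with computational basis $\{|I\rangle : I\in\{0,1\}^n\}$. Put $$A=\begin{pmatrix} i&0\\0&-i\end{pmatrix},\qquad B=\begin{pmatrix} 0&1\\-1&0\end{pmatrix},\qquad C=\begin{pmatrix} 0&i\\ i&0\end{pmatrix},$$ and for $1\le k\le n$ let $A_k,B_k,C_k$ be the operators on $H$ acting as $A,B,C$, respectively, on the $k$-th tensor factor and as the identity on the other factors. For a nonzero vector $|\psi\rangle\in H$ let $M_\psi$ be the $2^n\times(3n+1)$ complex matrix whose columns are the coordinate vectors of $$A_1|\psi\rangle,\,B_1|\psi\rangle,\,C_1|\psi\rangle,\,\ldots,\,A_n|\psi\rangle,\,B_n|\psi\rangle,\,C_n|\psi\rangle,\,-i|\psi\rangle ,$$ let $\operatorname{rank}_{\mathbb R}M_\psi$ be the dimension over $\mathbb R$ of the real span of its columns, and let $T_k=\{A_k|\psi\rangle,B_k|\psi\rangle,C_k|\psi\rangle\}$ for $1\le k\le n$. If $\operatorname{rank}_{\mathbb R}M_\psi$ is minimum, that is, $\operatorname{rank}_{\mathbb R}M_\psi\le\operatorname{rank}_{\mathbb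 R}M_\varphi$ for every nonzero $|\varphi\rangle\in H$, then there are $1\le l<l'\le n$ such that the real span of $T_l\cup T_{l'}$ has dimension exactly $3$ over $\mathbb R$. -/

import Mathlib

/-- State vectors of `n` qubits, written in the computational basis: the coordinate of `ψ` at the
multi-index `I : Fin n → Fin 2` is the coefficient of `|I⟩`. -/
abbrev QubitVec (n : ℕ) : Type := (Fin n → Fin 2) → ℂ

/-- The basis `A = i σ_z`, `B = i σ_y`, `C = i σ_x` of `su(2)`, indexed by `0, 1, 2`. -/
def su2Basis : Fin 3 → Matrix (Fin 2) (Fin 2) ℂ :=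
  ![!![Complex.I, 0; 0, -Complex.I], !![0, 1; -1, 0], !![0, Complex.I; Complex.I, 0]]

/-- The action of a `2 × 2` matrix on the `k`-th tensor factor of `(ℂ²)^{⊗ n}`. -/
def actAt {n : ℕ} (X : Matrix (Fin 2) (Fin 2) ℂ) (k : Fin n) (ψ : QubitVec n) : QubitVec n :=
  fun I => ∑ b : Fin 2, X (I k) b * ψ (Function.update I k b)

/-- The `2^n × (3n+1)` complex matrix whose columns are `A_k ψ`, `B_k ψ`, `C_k ψ`
(indexed by `Sum.inl (k, 0)`, `Sum.inl (k, 1)`, `Sum.inl (k, 2)`) and `-i ψ`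
(indexed by `Sum.inr ()`). -/
def stateMatrix {n : ℕ} (ψ : QubitVec n) :
    Matrix (Fin n → Fin 2) ((Fin n × Fin 3) ⊕ Unit) ℂ :=
  Matrix.of fun I c =>
    match c with
    | Sum.inl (k, a) => actAt (su2Basis a) k ψ I
    | Sum.inr _ => -Complex.I * ψ I

/-- The real rank of a complex matrix: the dimension over `ℝ` of the real span of its columns. -/
noncomputable def realRank {m c : Type*} (M : Matrix m c ℂ) : ℕ :=
  Module.finrank ℝ (Submodule.span ℝ (Set.range M.col))

/-- The triple `T_k = {A_k ψ, B_k ψ, C_k ψ}` of columns of `stateMatrix ψ`. -/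
def triple {n : ℕ} (ψ : QubitVec n) (k : Fin n) : Set (QubitVec n) :=
  Set.range fun a : Fin 3 => (stateMatrix ψ).col (Sum.inl (k, a))

open scoped Matrix

/-! Identify `su(2)` with ℝ³ under the cross product, and let K ⊆ (ℝ³)ⁿ be the Lie algebra of local
operators acting on ψ as imaginary scalars. By rank-nullity the real rank is at least 3n + 1 − dim
K. A singlet times |0…0⟩ has rank at most 2n, so a minimizing ψ has dim K ≥ n + 1. Each projection
of K to a factor is all of ℝ³ or at most a line. The full factors fall into classes of linked ones,
and K is determined by one vector per class and one scalar per remaining factor. If every class had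
three members, dim K ≤ n would follow (`finrank_le_card_of_three_le_linked`). So some class has at
most two. K contains elements supported on that class, killing ψ, with any prescribed value at one
member (`exists_supported_apply_eq`). One member is impossible, since nonzero elements of `su(2)`
are invertible; two members make the two triples span the same space. -/

/-! ### Cross product identities in ℝ³ -/

theorem exists_cross_eq (v : Fin 3 → ℝ) : ∃ a b : Fin 3 → ℝ, a ⨯₃ b = v := by
  by_cases h : v 0 ^ 2 + v 1 ^ 2 = 0
  · have h0 : v 0 = 0 := by nlinarith [sq_nonneg (v 0), sq_nonneg (v 1)]
    have h1 : v 1 = 0 := by nlinarith [sq_nonneg (v 0), sq_nonneg (v 1)]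
    refine ⟨![1, 0, 0], ![0, v 2, 0], ?_⟩
    ext i
    fin_cases i <;> simp [cross_apply, h0, h1]
  -- Take a ≠ 0 orthogonal to v and b = (v × a) / |a|².
  · refine ⟨![-v 1, v 0, 0], (v 0 ^ 2 + v 1 ^ 2)⁻¹ •
      ![-(v 2 * v 0), -(v 2 * v 1), v 0 ^ 2 + v 1 ^ 2], ?_⟩
    rw [map_smul, inv_smul_eq_iff₀ h]
    ext i
    fin_cases i <;> simp [cross_apply, -mul_eq_mul_right_iff] <;> ring

/-- Expansion of w in the basis a, b, a × b by means of its dual basis, with denominators cleared.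
-/
theorem cross_mul_dotProduct_smul (a b w : Fin 3 → ℝ) :
    (a ⨯₃ b ⬝ᵥ a ⨯₃ b) • w = (w ⬝ᵥ b ⨯₃ (a ⨯₃ b)) • a + (w ⬝ᵥ (a ⨯₃ b) ⨯₃ a) • b
      + (w ⬝ᵥ a ⨯₃ b) • (a ⨯₃ b) := by
  simp only [cross_apply, Matrix.vec3_dotProduct]
  ext i
  fin_cases i <;> simp <;> ring

theorem dotProduct_self_ne_zero {v : Fin 3 → ℝ} (hv : v ≠ 0) : v ⬝ᵥ v ≠ 0 :=
  fun h => hv (dotProduct_self_eq_zero.mp h)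

theorem eq_zero_of_cross_eq_zero {v x : Fin 3 → ℝ} (hv : v ≠ 0) (hc : x ⨯₃ v = 0)
    (hd : v ⬝ᵥ x = 0) : x = 0 := by
  have h := cross_cross_eq_smul_sub_smul' v x v
  rw [hc, map_zero, dotProduct_comm x v, hd, zero_smul, sub_zero] at h
  exact (smul_eq_zero.mp h.symm).resolve_left (dotProduct_self_ne_zero hv)

/-! ### Lie subalgebras of a power of `su(2)` -/

/-- Closure of a space of `ι`-indexed families of vectors of `ℝ³` under the componentwise cross
product. -/
def IsCrossClosed {ι : Type*} (K : Submodule ℝ (ι → Fin 3 → ℝ)) : Prop :=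
  ∀ x ∈ K, ∀ y ∈ K, (fun k => x k ⨯₃ y k) ∈ K

/-- The projection of `K` to the factor `k` is not commutative. -/
def IsNonabelianAt {ι : Type*} (K : Submodule ℝ (ι → Fin 3 → ℝ)) (k : ι) : Prop :=
  ∃ x ∈ K, ∃ y ∈ K, x k ⨯₃ y k ≠ 0

/-- The factors `k` and `l` are linked if the elements of `K` vanish at both or at none of them. -/
def linkedSetoid {ι : Type*} (K : Submodule ℝ (ι → Fin 3 → ℝ)) : Setoid ι where
  r k l := ∀ x ∈ K, x k = 0 ↔ x l = 0
  iseqv := ⟨fun _ _ _ => Iff.rfl, fun h x hx => (h x hx).symm,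
    fun h h' x hx => (h x hx).trans (h' x hx)⟩

section CrossClosed

variable {ι : Type*} {K : Submodule ℝ (ι → Fin 3 → ℝ)}

/-- Two noncommuting vectors and their cross product already form a basis of ℝ³. -/
theorem IsNonabelianAt.exists_apply_eq (hK : IsCrossClosed K) {k : ι} (hk : IsNonabelianAt K k)
    (v : Fin 3 → ℝ) : ∃ x ∈ K, x k = v := by
  obtain ⟨x, hx, y, hy, h⟩ := hk
  have h' := dotProduct_self_ne_zero h
  refine ⟨(x k ⨯₃ y k ⬝ᵥ x k ⨯₃ y k)⁻¹ • ((v ⬝ᵥ y k ⨯₃ (x k ⨯₃ y k)) • x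
    + (v ⬝ᵥ (x k ⨯₃ y k) ⨯₃ x k) • y + (v ⬝ᵥ x k ⨯₃ y k) • (fun j => x j ⨯₃ y j)), ?_, ?_⟩
  · exact K.smul_mem _ (K.add_mem (K.add_mem (K.smul_mem _ hx) (K.smul_mem _ hy))
      (K.smul_mem _ (hK x hx y hy)))
  · simp only [Pi.smul_apply, Pi.add_apply]
    rw [inv_smul_eq_iff₀ h', cross_mul_dotProduct_smul]

/-- The elements vanishing at l form an ideal of K; its image at k is a nonzero ideal of ℝ³, which
is simple. -/
theorem exists_apply_eq_of_vanishing (hK : IsCrossClosed K) {k l : ι} (hk : IsNonabelianAt K k)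
    (h : ∃ x ∈ K, x l = 0 ∧ x k ≠ 0) (v : Fin 3 → ℝ) : ∃ x ∈ K, x l = 0 ∧ x k = v := by
  obtain ⟨x, hx, hxl, hxk⟩ := h
  obtain ⟨y, hy, rfl⟩ := hk.exists_apply_eq hK v
  obtain ⟨z, hz, hzk⟩ := hk.exists_apply_eq hK (y k ⨯₃ x k)
  -- Solve x × (y × x) = |x|² y − (x · y) x for y; both terms used vanish at l because x does.
  refine ⟨(x k ⬝ᵥ x k)⁻¹ • ((fun j => x j ⨯₃ (y j ⨯₃ x j)) + (x k ⬝ᵥ y k) • x), ?_, ?_, ?_⟩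
  · exact K.smul_mem _ (K.add_mem (hK x hx _ (hK y hy x hx)) (K.smul_mem _ hx))
  · simp [hxl]
  · simp only [Pi.smul_apply, Pi.add_apply]
    rw [inv_smul_eq_iff₀ (dotProduct_self_ne_zero hxk), cross_cross_eq_smul_sub_smul',
      dotProduct_comm (y k), sub_add_cancel]

theorem exists_vanishing_of_not_linked (hK : IsCrossClosed K) {k l : ι} (hk : IsNonabelianAt K k)
    (hkl : ¬ linkedSetoid K k l) : ∃ x ∈ K, x l = 0 ∧ x k ≠ 0 := by
  by_contra! hne
  have hy : ∃ y ∈ K, y k = 0 ∧ y l ≠ 0 := by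
    by_contra! hne'
    exact hkl fun x hx => ⟨hne' x hx, hne x hx⟩
  obtain ⟨x, hx, w, hw, hxw⟩ := hk
  by_cases hl : IsNonabelianAt K l
  -- Here z agrees with x at l but vanishes at k, so x − z vanishes at l and hence at k, forcing x k
  -- = 0.
  · obtain ⟨z, hz, hzk, hzl⟩ := exists_apply_eq_of_vanishing hK hl hy (x l)
    have h := hne (x - z) (K.sub_mem hx hz) (by simp [hzl])
    simp only [Pi.sub_apply, hzk, sub_zero] at h
    simp [h] at hxw
  · simp only [IsNonabelianAt, not_exists, not_and, not_not] at hl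
    exact hxw (hne _ (hK x hx w hw) (hl x hx w hw))

/-- The bracket of an element vanishing on F with one vanishing at l vanishes on both. Since every
vector is a cross product, the value at k stays arbitrary, and bracketing lands in K₀. -/
theorem exists_supported_apply_eq (hK : IsCrossClosed K) {K₀ : Submodule ℝ (ι → Fin 3 → ℝ)}
    (hle : K₀ ≤ K) (hK₀ : ∀ x ∈ K, ∀ y ∈ K, (fun k => x k ⨯₃ y k) ∈ K₀)
    {k : ι} (hk : IsNonabelianAt K k) (F : Finset ι) :
    (∀ l ∈ F, ¬ linkedSetoid K k l) → ∀ v : Fin 3 → ℝ, ∃ x ∈ K₀, x k = v ∧ ∀ l ∈ F, x l = 0 := by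
  classical
  induction F using Finset.induction_on with
  | empty =>
    intro _ v
    obtain ⟨a, b, rfl⟩ := exists_cross_eq v
    obtain ⟨x, hx, rfl⟩ := hk.exists_apply_eq hK a
    obtain ⟨y, hy, rfl⟩ := hk.exists_apply_eq hK b
    exact ⟨_, hK₀ x hx y hy, rfl, by simp⟩
  | insert l F _ ih =>
    intro hF v
    obtain ⟨a, b, rfl⟩ := exists_cross_eq v
    obtain ⟨x, hx, rfl, hxF⟩ := ih (fun j hj => hF j (Finset.mem_insert_of_mem hj)) a
    obtain ⟨y, hy, hyl, rfl⟩ := exists_apply_eq_of_vanishing hK hk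
      (exists_vanishing_of_not_linked hK hk (hF l (Finset.mem_insert_self _ _))) b
    refine ⟨_, hK₀ x (hle hx) y hy, rfl, fun j hj => ?_⟩
    rcases Finset.mem_insert.mp hj with rfl | hj
    · simp [hyl]
    · simp [hxF j hj]

theorem exists_functional_of_not_nonabelian {k : ι} (hk : ¬ IsNonabelianAt K k) :
    ∃ v : Fin 3 → ℝ, ∀ x ∈ K, v ⬝ᵥ x k = 0 → x k = 0 := by
  simp only [IsNonabelianAt, not_exists, not_and, not_not] at hk
  by_cases h : ∃ y ∈ K, y k ≠ 0
  · obtain ⟨y, hy, hyk⟩ := h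
    exact ⟨y k, fun x hx h => eq_zero_of_cross_eq_zero hyk (hk x hx y hy) h⟩
  · push Not at h
    exact ⟨0, fun x hx _ => h x hx⟩

open Classical in
/-- If every noncommutative factor is linked to at least three factors, then `K` has dimension at
most the number of factors. -/
theorem finrank_le_card_of_three_le_linked [Fintype ι]
    (h : ∀ k, IsNonabelianAt K k →
      3 ≤ (Finset.univ.filter fun l => IsNonabelianAt K l ∧ linkedSetoid K l k).card) :
    Module.finrank ℝ K ≤ Fintype.card ι := by
  set S : Finset ι := Finset.univ.filter (IsNonabelianAt K)
  set q : ι → Quotient (linkedSetoid K) := Quotient.mk _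
  have hS : 3 * (S.image q).card ≤ S.card := by
    refine Finset.mul_card_image_le_card S 3 fun r hr => ?_
    obtain ⟨k, hk, rfl⟩ := Finset.mem_image.mp hr
    refine (h k (Finset.mem_filter.mp hk).2).trans (Finset.card_le_card fun l hl => ?_)
    simp only [Finset.mem_filter, Finset.mem_univ, true_and, S] at hl ⊢
    exact ⟨hl.1, Quotient.sound hl.2⟩
  have hf : ∀ k : ↥Sᶜ, ∃ v : Fin 3 → ℝ, ∀ x ∈ K, v ⬝ᵥ x k = 0 → x k = 0 := fun k =>
    exists_functional_of_not_nonabelian fun hk => by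
      have := k.2
      simp [S, hk] at this
  choose v hv using hf
  -- One vector per class, read at a representative, and one scalar per commutative factor.
  let f : K →ₗ[ℝ] (↥(S.image q) → Fin 3 → ℝ) × (↥Sᶜ → ℝ) :=
    { toFun := fun x => (fun r => x.1 (Quotient.out r.1), fun k => v k ⬝ᵥ x.1 k)
      map_add' := fun x y => by ext <;> simp
      map_smul' := fun c x => by ext <;> simp }
  have hinj : Function.Injective f := by
    rw [injective_iff_map_eq_zero]
    intro x hx
    obtain ⟨h1, h2⟩ := Prod.ext_iff.mp hx
    ext1
    ext1 k
    by_cases hk : k ∈ S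
    · have hr : q k ∈ S.image q := Finset.mem_image_of_mem q hk
      have h3 : x.1 (q k).out = 0 := congrFun h1 ⟨q k, hr⟩
      exact ((Quotient.mk_out (s := linkedSetoid K) k) x.1 x.2).mp h3
    · exact hv ⟨k, by simpa using hk⟩ x.1 x.2 (congrFun h2 ⟨k, by simpa using hk⟩)
  have hdim := LinearMap.finrank_le_finrank_of_injective hinj
  simp only [Module.finrank_prod, Module.finrank_pi_fintype, Module.finrank_self,
    Finset.sum_const, Finset.card_univ, Fintype.card_coe, Fintype.card_fin, smul_eq_mul,
    Finset.card_compl] at hdim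
  have := S.card_le_univ
  omega

end CrossClosed

/-! ### `su(2)` matrices and their action on tensor factors -/

/-- The element of `su(2)` with the given real coordinates in `su2Basis`. -/
noncomputable def su2Matrix (v : Fin 3 → ℝ) : Matrix (Fin 2) (Fin 2) ℂ :=
  ∑ a, (v a : ℂ) • su2Basis a

theorem su2Matrix_eq (v : Fin 3 → ℝ) :
    su2Matrix v = !![v 0 * Complex.I, v 1 + v 2 * Complex.I;
      -v 1 + v 2 * Complex.I, -(v 0 * Complex.I)] := by
  ext i j
  fin_cases i <;> fin_cases j <;> simp [su2Matrix, su2Basis, Fin.sum_univ_three]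

theorem su2Matrix_mul_self (v : Fin 3 → ℝ) :
    su2Matrix v * su2Matrix v = (-(v ⬝ᵥ v : ℝ) : ℂ) • 1 := by
  rw [su2Matrix_eq]
  ext i j
  fin_cases i <;> fin_cases j <;>
    simp [Matrix.vec3_dotProduct] <;> ring_nf <;> simp <;> ring

theorem su2Matrix_commutator (v w : Fin 3 → ℝ) :
    su2Matrix v * su2Matrix w - su2Matrix w * su2Matrix v = (2 : ℂ) • su2Matrix (v ⨯₃ w) := by
  simp only [su2Matrix_eq, cross_apply]
  ext i j
  fin_cases i <;> fin_cases j <;>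
    simp <;> ring_nf <;> simp <;> ring

section ActAt

variable {n : ℕ}

theorem actAt_add (X : Matrix (Fin 2) (Fin 2) ℂ) (k : Fin n) (ψ φ : QubitVec n) :
    actAt X k (ψ + φ) = actAt X k ψ + actAt X k φ := by
  ext I
  simp [actAt, mul_add]
  ring

theorem actAt_smul (X : Matrix (Fin 2) (Fin 2) ℂ) (k : Fin n) (c : ℂ) (ψ : QubitVec n) :
    actAt X k (c • ψ) = c • actAt X k ψ := by
  ext I
  simp [actAt]
  ring

/-- `actAt` as a linear endomorphism, linear in the matrix as well. -/
noncomputable def actAtHom (k : Fin n) :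
    Matrix (Fin 2) (Fin 2) ℂ →ₗ[ℂ] Module.End ℂ (QubitVec n) :=
  LinearMap.mk₂ ℂ (fun X ψ => actAt X k ψ)
    (fun X Y ψ => by ext I; simp [actAt]; ring)
    (fun c X ψ => by ext I; simp [actAt]; ring)
    (fun X ψ φ => actAt_add X k ψ φ)
    (fun c X ψ => actAt_smul X k c ψ)

@[simp]
theorem actAtHom_apply (k : Fin n) (X : Matrix (Fin 2) (Fin 2) ℂ) (ψ : QubitVec n) :
    actAtHom k X ψ = actAt X k ψ := rfl

theorem actAtHom_mul (k : Fin n) (X Y : Matrix (Fin 2) (Fin 2) ℂ) :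
    actAtHom k X * actAtHom k Y = actAtHom k (X * Y) := by
  refine LinearMap.ext fun ψ => funext fun I => ?_
  simp [actAt, Matrix.mul_apply]
  ring

theorem actAtHom_one (k : Fin n) : actAtHom k 1 = 1 := by
  refine LinearMap.ext fun ψ => funext fun I => ?_
  simp [actAt, Matrix.one_apply]

theorem actAtHom_mul_comm {k l : Fin n} (h : k ≠ l) (X Y : Matrix (Fin 2) (Fin 2) ℂ) :
    actAtHom k X * actAtHom l Y = actAtHom l Y * actAtHom k X := by
  refine LinearMap.ext fun ψ => funext fun I => ?_
  simp only [Module.End.mul_apply, actAtHom_apply, actAt, Finset.mul_sum]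
  rw [Finset.sum_comm]
  refine Finset.sum_congr rfl fun a _ => Finset.sum_congr rfl fun b _ => ?_
  rw [Function.update_of_ne h.symm, Function.update_of_ne h, Function.update_comm h]
  ring

/-- The infinitesimal local unitary `∑ₖ X(xₖ)ₖ`. -/
noncomputable def localAction (x : Fin n → Fin 3 → ℝ) : Module.End ℂ (QubitVec n) :=
  ∑ k, actAtHom k (su2Matrix (x k))

theorem su2Matrix_add (v w : Fin 3 → ℝ) : su2Matrix (v + w) = su2Matrix v + su2Matrix w := by
  simp [su2Matrix, add_smul, Finset.sum_add_distrib]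

theorem su2Matrix_smul (c : ℝ) (v : Fin 3 → ℝ) : su2Matrix (c • v) = (c : ℂ) • su2Matrix v := by
  simp [su2Matrix, Finset.smul_sum, mul_smul]

theorem su2Matrix_zero : su2Matrix 0 = 0 := by simp [su2Matrix]

theorem localAction_add (x y : Fin n → Fin 3 → ℝ) :
    localAction (x + y) = localAction x + localAction y := by
  simp [localAction, su2Matrix_add, Finset.sum_add_distrib]

theorem localAction_smul (c : ℝ) (x : Fin n → Fin 3 → ℝ) :
    localAction (c • x) = (c : ℂ) • localAction x := by
  simp [localAction, su2Matrix_smul, Finset.smul_sum]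

theorem localAction_zero : localAction (0 : Fin n → Fin 3 → ℝ) = 0 := by
  simp only [localAction, Pi.zero_apply, su2Matrix_zero, map_zero, Finset.sum_const_zero]

theorem localAction_commutator (x y : Fin n → Fin 3 → ℝ) :
    localAction x * localAction y - localAction y * localAction x
      = (2 : ℂ) • localAction fun k => x k ⨯₃ y k := by
  simp only [localAction, Finset.sum_mul_sum]
  rw [Finset.sum_comm (f := fun i j => actAtHom i (su2Matrix (y i)) * actAtHom j (su2Matrix (x j))),
    ← Finset.sum_sub_distrib, Finset.smul_sum]
  refine Finset.sum_congr rfl fun k _ => ?_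
  rw [← Finset.sum_sub_distrib, Finset.sum_eq_single k]
  · rw [actAtHom_mul, actAtHom_mul, ← map_sub, su2Matrix_commutator, map_smul]
  · intro l _ hl
    rw [actAtHom_mul_comm hl, sub_self]
  · simp

/-- The square of the operator is the scalar −|v|². -/
theorem eq_zero_of_actAt_su2Matrix_eq_zero {ψ : QubitVec n} (hψ : ψ ≠ 0) {k : Fin n}
    {v : Fin 3 → ℝ} (h : actAt (su2Matrix v) k ψ = 0) : v = 0 := by
  have h2 : (actAtHom k (su2Matrix v) * actAtHom k (su2Matrix v)) ψ = 0 := by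
    rw [Module.End.mul_apply, actAtHom_apply k _ ψ, h, map_zero]
  rw [actAtHom_mul, su2Matrix_mul_self, map_smul, actAtHom_one] at h2
  simpa [hψ] using h2

end ActAt

/-! ### The stabilizer algebra of a state -/

section Stabilizer

variable {n : ℕ}

/-- The annihilator of `ψ` among the infinitesimal local special unitaries. -/
noncomputable def localAnnihilator (ψ : QubitVec n) : Submodule ℝ (Fin n → Fin 3 → ℝ) where
  carrier := {x | localAction x ψ = 0}
  add_mem' := fun {x y} hx hy => by
    simp only [Set.mem_ofPred_eq] at hx hy ⊢
    simp [localAction_add, hx, hy]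
  zero_mem' := by simp [localAction_zero]
  smul_mem' := fun c x hx => by
    simp only [Set.mem_ofPred_eq] at hx ⊢
    simp [localAction_smul, hx]

/-- The infinitesimal local special unitaries that fix the ray of `ψ`. -/
noncomputable def localStabilizer (ψ : QubitVec n) : Submodule ℝ (Fin n → Fin 3 → ℝ) where
  carrier := {x | ∃ c : ℝ, localAction x ψ = (c * Complex.I) • ψ}
  add_mem' := by
    rintro x y ⟨c, hc⟩ ⟨d, hd⟩
    exact ⟨c + d, by simp [localAction_add, hc, hd, add_mul, add_smul]⟩
  zero_mem' := ⟨0, by simp [localAction_zero]⟩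
  smul_mem' := by
    rintro a x ⟨c, hc⟩
    exact ⟨a * c, by simp only [localAction_smul, LinearMap.smul_apply, hc]; simp [smul_smul, mul_assoc]⟩

theorem localAnnihilator_le (ψ : QubitVec n) : localAnnihilator ψ ≤ localStabilizer ψ :=
  fun x (hx : localAction x ψ = 0) => ⟨0, by simp [hx]⟩

/-- Both operators act on ψ as scalars, so their commutator kills it. -/
theorem cross_mem_localAnnihilator (ψ : QubitVec n) :
    ∀ x ∈ localStabilizer ψ, ∀ y ∈ localStabilizer ψ,
      (fun k => x k ⨯₃ y k) ∈ localAnnihilator ψ := by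
  rintro x ⟨c, hc⟩ y ⟨d, hd⟩
  have h := congrArg (fun f : Module.End ℂ (QubitVec n) => f ψ) (localAction_commutator x y)
  simp only [LinearMap.sub_apply, Module.End.mul_apply, hc, hd, map_smul, LinearMap.smul_apply] at h
  rw [smul_comm, sub_self] at h
  exact (smul_eq_zero.mp h.symm).resolve_left two_ne_zero

end Stabilizer

/-! ### Spans of columns and rank-nullity -/

section Columns

variable {n : ℕ}

theorem actAt_su2Matrix (v : Fin 3 → ℝ) (k : Fin n) (ψ : QubitVec n) :
    actAt (su2Matrix v) k ψ = ∑ a, v a • actAt (su2Basis a) k ψ := by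
  rw [← actAtHom_apply, su2Matrix, map_sum, LinearMap.sum_apply]
  refine Finset.sum_congr rfl fun a _ => ?_
  rw [map_smul]
  rfl

theorem triple_eq (ψ : QubitVec n) (k : Fin n) :
    triple ψ k = Set.range fun a => actAt (su2Basis a) k ψ := rfl

theorem mem_span_triple_iff {ψ φ : QubitVec n} {k : Fin n} :
    φ ∈ Submodule.span ℝ (triple ψ k) ↔ ∃ v, actAt (su2Matrix v) k ψ = φ := by
  simp_rw [triple_eq, Submodule.mem_span_range_iff_exists_fun, actAt_su2Matrix]

theorem finrank_span_triple {ψ : QubitVec n} (hψ : ψ ≠ 0) (k : Fin n) :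
    Module.finrank ℝ (Submodule.span ℝ (triple ψ k)) = 3 := by
  rw [triple_eq, finrank_span_eq_card, Fintype.card_fin]
  rw [Fintype.linearIndependent_iff]
  intro v hv
  rw [← actAt_su2Matrix] at hv
  exact fun a => congrFun (eq_zero_of_actAt_su2Matrix_eq_zero hψ hv) a

theorem finrank_span_triple_union {ψ : QubitVec n} (hψ : ψ ≠ 0) {k l : Fin n}
    (h : ∀ v, ∃ w, actAt (su2Matrix v) k ψ = actAt (su2Matrix w) l ψ) :
    Module.finrank ℝ (Submodule.span ℝ (triple ψ k ∪ triple ψ l)) = 3 := by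
  rw [Submodule.span_union, sup_eq_right.mpr, finrank_span_triple hψ]
  intro φ hφ
  obtain ⟨v, rfl⟩ := mem_span_triple_iff.mp hφ
  obtain ⟨w, hw⟩ := h v
  exact mem_span_triple_iff.mpr ⟨w, hw.symm⟩

/-- Rank-nullity for the columns of `stateMatrix ψ`. -/
theorem le_realRank_add_finrank_localStabilizer {ψ : QubitVec n} (hψ : ψ ≠ 0) :
    3 * n + 1 ≤ realRank (stateMatrix ψ) + Module.finrank ℝ (localStabilizer ψ) := by
  set L := Fintype.linearCombination ℝ (stateMatrix ψ).col with hL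
  have hLapp : ∀ t, L t = localAction (fun k a => t (Sum.inl (k, a))) ψ
      - (t (Sum.inr ()) * Complex.I : ℂ) • ψ := by
    intro t
    rw [hL, Fintype.linearCombination_apply, Fintype.sum_sum_type, Fintype.sum_prod_type,
      localAction, LinearMap.sum_apply, sub_eq_add_neg]
    congr 1
    · exact Finset.sum_congr rfl fun k _ => (actAt_su2Matrix _ k ψ).symm
    · ext I
      simp [stateMatrix, Matrix.col]
      ring
  have hrank : Module.finrank ℝ (LinearMap.range L) = realRank (stateMatrix ψ) := by
    rw [hL, Fintype.range_linearCombination, realRank]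
  have hnull := LinearMap.finrank_range_add_finrank_ker L
  simp only [Module.finrank_fintype_fun_eq_card, Fintype.card_sum, Fintype.card_prod,
    Fintype.card_fin, Fintype.card_unit] at hnull
  let f : LinearMap.ker L →ₗ[ℝ] localStabilizer ψ :=
    { toFun := fun t => ⟨fun k a => t.1 (Sum.inl (k, a)), t.1 (Sum.inr ()), by
        have := t.2
        rwa [LinearMap.mem_ker, hLapp, sub_eq_zero] at this⟩
      map_add' := fun _ _ => rfl
      map_smul' := fun _ _ => rfl }
  -- Forgetting the coefficient of −iψ loses nothing: it is determined by the others because ψ ≠ 0.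
  have hf : Function.Injective f := by
    rw [injective_iff_map_eq_zero]
    intro t ht
    have h1 : (fun k a => t.1 (Sum.inl (k, a))) = (0 : Fin n → Fin 3 → ℝ) := congrArg Subtype.val ht
    have h2 := t.2
    rw [LinearMap.mem_ker, hLapp, h1] at h2
    have h3 : t.1 (Sum.inr ()) = 0 := by
      simpa [localAction_zero, hψ] using h2
    ext (⟨k, a⟩ | _)
    · exact congrFun (congrFun h1 k) a
    · exact h3
  have := LinearMap.finrank_le_finrank_of_injective hf
  omega

end Columns
-- A state of rank at most 2n
/-- The singlet on the first two qubits times `|0⟩` on each of the others. -/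
def singletZeros (m : ℕ) : QubitVec (m + 2) := fun I =>
  (if I 0 = I 1 then 0 else if I 0 = 0 then 1 else -1) *
    if ∀ k : Fin m, I k.succ.succ = 0 then 1 else 0

theorem singletZeros_ne_zero (m : ℕ) : singletZeros m ≠ 0 := by
  intro h
  have := congrFun h (Pi.single 1 1)
  simp [singletZeros, Fin.ext_iff] at this

/-- The singlet is annihilated by every X ⊗ 1 + 1 ⊗ X with X in `su(2)`. -/
theorem actAt_zero_singletZeros (m : ℕ) (a : Fin 3) :
    actAt (su2Basis a) 1 (singletZeros m) = -actAt (su2Basis a) 0 (singletZeros m) := by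
  ext I
  simp only [actAt, singletZeros, Fin.sum_univ_two, Pi.neg_apply, Function.update_self]
  rw [Function.update_of_ne (by simp : (0 : Fin (m + 2)) ≠ 1),
    Function.update_of_ne (by simp : (0 : Fin (m + 2)) ≠ 1),
    Function.update_of_ne (by simp : (1 : Fin (m + 2)) ≠ 0),
    Function.update_of_ne (by simp : (1 : Fin (m + 2)) ≠ 0)]
  have h0 : ∀ (k : Fin m), k.succ.succ ≠ 0 := fun k => Fin.succ_ne_zero _
  have h1 : ∀ (k : Fin m), k.succ.succ ≠ 1 := fun k => by simp [Fin.ext_iff]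
  simp only [Function.update_of_ne (h0 _), Function.update_of_ne (h1 _)]
  generalize (if ∀ k : Fin m, I k.succ.succ = 0 then (1 : ℂ) else 0) = c
  generalize I 0 = i
  generalize I 1 = j
  fin_cases a <;> fin_cases i <;> fin_cases j <;> simp [su2Basis]

theorem actAt_succ_singletZeros (m : ℕ) (k : Fin m) :
    actAt (su2Basis 0) k.succ.succ (singletZeros m) = Complex.I • singletZeros m := by
  ext I
  simp only [actAt, singletZeros, Fin.sum_univ_two, Pi.smul_apply]
  simp only [Function.update_of_ne (Fin.succ_ne_zero k.succ).symm,
    Function.update_of_ne (by simp [Fin.ext_iff] : (1 : Fin (m + 2)) ≠ k.succ.succ)]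
  have h1 : ¬ ∀ j : Fin m, Function.update I k.succ.succ 1 j.succ.succ = 0 := fun h => by
    simpa using h k
  rw [if_neg h1]
  by_cases hk : I k.succ.succ = 0
  · have h0 : Function.update I k.succ.succ 0 = I := Function.update_eq_self_iff.mpr hk.symm
    simp [su2Basis, hk, h0]
  · have hk1 : I k.succ.succ = 1 := by omega
    have h0 : ¬ ∀ j : Fin m, I j.succ.succ = 0 := fun h => hk (h k)
    simp [su2Basis, hk1, h0]

/-- Three columns for the singlet, the B and C columns for each of the m other qubits, and −iψ: 3 +
2m + 1 = 2(m + 2). -/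
theorem realRank_singletZeros_le (m : ℕ) :
    realRank (stateMatrix (singletZeros m)) ≤ 2 * (m + 2) := by
  let b : Fin 3 ⊕ (Fin m × Fin 2) ⊕ Unit → QubitVec (m + 2) := Sum.elim
    (fun a => actAt (su2Basis a) 0 (singletZeros m))
    (Sum.elim (fun p => actAt (su2Basis p.2.succ) p.1.succ.succ (singletZeros m))
      (fun _ => -Complex.I • singletZeros m))
  have hle : Submodule.span ℝ (Set.range (stateMatrix (singletZeros m)).col)
      ≤ Submodule.span ℝ (Set.range b) := by
    rw [Submodule.span_le]
    rintro _ ⟨⟨k, a⟩ | u, rfl⟩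
    · change actAt (su2Basis a) k (singletZeros m) ∈ Submodule.span ℝ (Set.range b)
      induction k using Fin.cases with
      | zero => exact Submodule.subset_span ⟨Sum.inl a, rfl⟩
      | succ k =>
        induction k using Fin.cases with
        | zero =>
          rw [Fin.succ_zero_eq_one, actAt_zero_singletZeros]
          exact Submodule.neg_mem _ (Submodule.subset_span ⟨Sum.inl a, rfl⟩)
        | succ k =>
          induction a using Fin.cases with
          | zero =>
            rw [actAt_succ_singletZeros, ← neg_neg (Complex.I • _), ← neg_smul]
            exact Submodule.neg_mem _ (Submodule.subset_span ⟨Sum.inr (Sum.inr ()), rfl⟩)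
          | succ a => exact Submodule.subset_span ⟨Sum.inr (Sum.inl (k, a)), rfl⟩
    · exact Submodule.subset_span ⟨Sum.inr (Sum.inr ()), rfl⟩
  have hb := finrank_range_le_card (R := ℝ) b
  simp only [Fintype.card_sum, Fintype.card_prod, Fintype.card_fin, Fintype.card_unit] at hb
  have := (Submodule.finrank_mono hle).trans hb
  rw [realRank]
  omega

/-! ### Small linked classes and the conclusion -/

theorem localAction_apply_of_support {n : ℕ} (x : Fin n → Fin 3 → ℝ) (s : Finset (Fin n))
    (hx : ∀ l ∉ s, x l = 0) (ψ : QubitVec n) :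
    localAction x ψ = ∑ l ∈ s, actAt (su2Matrix (x l)) l ψ := by
  rw [localAction, LinearMap.sum_apply]
  refine (Finset.sum_subset (Finset.subset_univ s) fun l _ hl => ?_).symm
  rw [hx l hl, su2Matrix_zero, map_zero, LinearMap.zero_apply]

theorem isCrossClosed_localStabilizer {n : ℕ} (ψ : QubitVec n) :
    IsCrossClosed (localStabilizer ψ) := fun x hx y hy =>
  localAnnihilator_le ψ (cross_mem_localAnnihilator ψ x hx y hy)

theorem IsNonabelianAt.of_linked {ι : Type*} {K : Submodule ℝ (ι → Fin 3 → ℝ)}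
    (hK : IsCrossClosed K) {k l : ι} (hk : IsNonabelianAt K k) (h : linkedSetoid K k l) :
    IsNonabelianAt K l := by
  obtain ⟨x, hx, y, hy, hxy⟩ := hk
  exact ⟨x, hx, y, hy, fun h0 => hxy ((h _ (hK x hx y hy)).mpr h0)⟩

-- On a class {k, l}, annihilators supported there turn each X acting at k on ψ into some Y acting
-- at l, so the span of one triple lies in that of the other.
open Classical in
theorem three_le_card_linked {n : ℕ} {ψ : QubitVec n} (hψ : ψ ≠ 0)
    (hpair : ∀ k l : Fin n, k ≠ l →
      Module.finrank ℝ (Submodule.span ℝ (triple ψ k ∪ triple ψ l)) ≠ 3)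
    {k : Fin n} (hk : IsNonabelianAt (localStabilizer ψ) k) :
    3 ≤ (Finset.univ.filter fun l => IsNonabelianAt (localStabilizer ψ) l ∧
      linkedSetoid (localStabilizer ψ) l k).card := by
  have hK := isCrossClosed_localStabilizer ψ
  set s := Finset.univ.filter fun l => IsNonabelianAt (localStabilizer ψ) l ∧
      linkedSetoid (localStabilizer ψ) l k with hs
  have hks : k ∈ s := by
    simp only [hs, Finset.mem_filter, Finset.mem_univ, true_and]
    exact ⟨hk, (linkedSetoid _).refl k⟩
  have hsupp : ∀ v, ∃ x : Fin n → Fin 3 → ℝ,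
      x k = v ∧ ∑ l ∈ s, actAt (su2Matrix (x l)) l ψ = 0 := by
    intro v
    obtain ⟨x, hx, hxk, hxs⟩ := exists_supported_apply_eq hK (localAnnihilator_le ψ)
      (cross_mem_localAnnihilator ψ) hk sᶜ (fun l hl hkl => by
        simp only [hs, Finset.mem_compl, Finset.mem_filter, Finset.mem_univ, true_and] at hl
        exact hl ⟨hk.of_linked hK hkl, (linkedSetoid _).symm hkl⟩) v
    refine ⟨x, hxk, ?_⟩
    rw [← localAction_apply_of_support x s (fun l hl => hxs l (Finset.mem_compl.mpr hl))]
    exact hx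
  have hpos : 0 < s.card := Finset.card_pos.mpr ⟨k, hks⟩
  by_contra! hlt
  obtain h1 | h2 : s.card = 1 ∨ s.card = 2 := by omega
  · obtain ⟨j, hj⟩ := Finset.card_eq_one.mp h1
    obtain rfl : k = j := by simpa [hj] using hks
    obtain ⟨x, hxk, hx⟩ := hsupp 1
    rw [hj, Finset.sum_singleton, hxk] at hx
    exact one_ne_zero (eq_zero_of_actAt_su2Matrix_eq_zero hψ hx)
  · obtain ⟨l, hl⟩ : ∃ l, s.erase k = {l} := by
      rw [← Finset.card_eq_one, Finset.card_erase_of_mem hks, h2]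
    have hlk : l ≠ k := Finset.ne_of_mem_erase (hl ▸ Finset.mem_singleton_self l)
    refine hpair k l hlk.symm (finrank_span_triple_union hψ fun v => ?_)
    obtain ⟨x, hxk, hx⟩ := hsupp v
    rw [← Finset.add_sum_erase _ _ hks, hl, Finset.sum_singleton, hxk, add_eq_zero_iff_eq_neg] at hx
    refine ⟨-x l, ?_⟩
    rw [hx, ← neg_one_smul ℝ (x l), su2Matrix_smul, ← actAtHom_apply, ← actAtHom_apply, map_smul]
    simp

theorem lemma4p1 (n : ℕ) (hn : 2 ≤ n) (ψ : QubitVec n) (hψ : ψ ≠ 0)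
    (hmin : ∀ φ : QubitVec n, φ ≠ 0 → realRank (stateMatrix ψ) ≤ realRank (stateMatrix φ)) :
    ∃ l l' : Fin n, l < l' ∧
      Module.finrank ℝ (Submodule.span ℝ (triple ψ l ∪ triple ψ l')) = 3 := by
  by_contra! hne
  have hpair : ∀ k l : Fin n, k ≠ l →
      Module.finrank ℝ (Submodule.span ℝ (triple ψ k ∪ triple ψ l)) ≠ 3 := by
    intro k l hkl
    rcases lt_or_gt_of_ne hkl with h | h
    · exact hne k l h
    · rw [Set.union_comm]
      exact hne l k h
  have hdim := finrank_le_card_of_three_le_linked fun _ hk => three_le_card_linked hψ hpair hk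
  have hrank := le_realRank_add_finrank_localStabilizer hψ
  rw [Fintype.card_fin] at hdim
  obtain ⟨m, rfl⟩ := Nat.exists_eq_add_of_le' hn
  have hmin' := hmin _ (singletZeros_ne_zero m)
  have := realRank_singletZeros_le m
  -- The bounds rank ≤ 2n and dim K ≤ n contradict 3n + 1 ≤ rank + dim K.
  omega
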